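/- Let $n\ge 1$, $s\in(0,\tfrac12)$, and let $\Omega\subseteq\mathbb{R}^n$ be open. For disjoint measurable sets $S_1,S_2\subseteq\mathbb{R}^n$ put $$I(S_1,S_2):=\iint_{S_1\times S_2}\frac{dx\,dy}{|x-y|^{n+2s}}\in[0,\infty],$$ and for measurable $E\subseteq\mathbb{R}^n$, with $E^c:=\mathbb{R}^n\setminus E$, define the $s$-perimeter of $E$ in $\Omega$ by $$\mathrm{Per}_s(E,\Omega):=I(E\cap\Omega,E^c\cap\Omega)+I(E\cap\Omega,E^c\setminus\Omega)+I(E\setminus\Omega,E^c\cap\Omega).$$ A measurable set $E$ minimizes the $s$-perimeter in $\Omega$ if $\mathrm{Per}_s(E,\Omega)<\infty$ and $\mathrm{Per}_s(E,\Omega)\le\mathrm{Per}_s(F,\Omega)$ for every measurable $F\subseteq\mathbb{R}^n$ with $F\setminus\Omega=E\setminus\Omega$. The set $E$ has smooth boundary if every $p\in\partial E$ has an open neighbourhood $U$ and a function $\varphi\in C^\infty(U)$ with $\varphi(p)=0$, $\nabla\varphi(p)\ne0$, $U\cap\{\varphi<0\}\subseteq E$ and $U\cap\{\varphi>0\}\subseteq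 E^c$. Lemma 1.1. If $E$ is a set with smooth boundary that minimizes the $s$-perimeter in $\Omega$, then for every $p\in(\partial E)\cap\Omega$ the nonlocal mean curvature of $E$ at $p$, defined as the principal value $$H^s_E(p):=\lim_{\rho\searrow0}\int_{\mathbb{R}^n\setminus B_\rho(p)}\frac{\chi_{E^c}(x)-\chi_E(x)}{|x-p|^{n+2s}}\,dx,$$ exists (each of these integrals converges absolutely) and $H^s_E(p)=0$. -/

import Mathlib

open MeasureTheory Set Filter Topology
open scoped ContDiff ENNReal

noncomputable section

/-- The interaction `I(S₁, S₂) = ∬_{S₁ × S₂} dx dy / |x - y|^{n + 2s}`, with values in `[0, ∞]`,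
for disjoint sets `S₁, S₂ ⊆ ℝⁿ`. -/
def sInteraction {n : ℕ} (s : ℝ) (S₁ S₂ : Set (EuclideanSpace ℝ (Fin n))) : ℝ≥0∞ :=
  ∫⁻ z in S₁ ×ˢ S₂, ENNReal.ofReal (1 / ‖z.1 - z.2‖ ^ ((n : ℝ) + 2 * s))

/-- The `s`-perimeter of `E` in `Ω`: all interactions between `E` and its complement, except the
one between `E \ Ω` and `Eᶜ \ Ω`. -/
def sPerimeter {n : ℕ} (s : ℝ) (E Ω : Set (EuclideanSpace ℝ (Fin n))) : ℝ≥0∞ :=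
  sInteraction s (E ∩ Ω) (Eᶜ ∩ Ω) + sInteraction s (E ∩ Ω) (Eᶜ \ Ω)
    + sInteraction s (E \ Ω) (Eᶜ ∩ Ω)

/-- `E` minimizes the `s`-perimeter in `Ω`: it is a (Lebesgue) measurable set of finite
`s`-perimeter in `Ω`, and no measurable set that coincides with `E` outside `Ω` has a smaller
`s`-perimeter in `Ω`. -/
structure IsSPerimeterMinimizer {n : ℕ} (s : ℝ) (E Ω : Set (EuclideanSpace ℝ (Fin n))) :
    Prop where
  nullMeasurableSet : NullMeasurableSet E volume
  sPerimeter_ne_top : sPerimeter s E Ω ≠ ⊤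
  sPerimeter_le : ∀ F : Set (EuclideanSpace ℝ (Fin n)), NullMeasurableSet F volume →
    F \ Ω = E \ Ω → sPerimeter s E Ω ≤ sPerimeter s F Ω

/-- `E` has smooth boundary: near each of its boundary points, `E` is, up to the points of the
boundary itself (which may or may not belong to `E`), the sublevel set `{φ < 0}` of a `C^∞`
function `φ` that vanishes at the point and has nonzero differential there. (So `∂E` is near that
point the smooth hypersurface `{φ = 0}`, and `E` lies locally on one side of it.) -/
def HasSmoothBoundary {n : ℕ} (E : Set (EuclideanSpace ℝ (Fin n))) : Prop :=
  ∀ p ∈ frontier E, ∃ (U : Set (EuclideanSpace ℝ (Fin n))) (φ : EuclideanSpace ℝ (Fin n) → ℝ),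
    IsOpen U ∧ p ∈ U ∧ ContDiffOn ℝ ∞ φ U ∧ φ p = 0 ∧ fderiv ℝ φ p ≠ 0 ∧
      (∀ x ∈ U, φ x < 0 → x ∈ E) ∧ (∀ x ∈ U, 0 < φ x → x ∉ E)

/-- The integrand `(χ_{Eᶜ}(x) - χ_E(x)) / |x - p|^{n + 2s}` of the nonlocal mean curvature. -/
def curvatureIntegrand {n : ℕ} (s : ℝ) (E : Set (EuclideanSpace ℝ (Fin n)))
    (p x : EuclideanSpace ℝ (Fin n)) : ℝ :=
  (Eᶜ.indicator (fun _ => (1 : ℝ)) x - E.indicator (fun _ => (1 : ℝ)) x)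
    / ‖x - p‖ ^ ((n : ℝ) + 2 * s)

/-- The nonlocal mean curvature `H^s_E(p)` exists, as a principal value, and is equal to `H`: the
integrand is integrable outside every ball around `p`, and the integrals over the complements of
the balls `B_ρ(p)` tend to `H` as `ρ ↘ 0`. -/
def HasNonlocalMeanCurvature {n : ℕ} (s : ℝ) (E : Set (EuclideanSpace ℝ (Fin n)))
    (p : EuclideanSpace ℝ (Fin n)) (H : ℝ) : Prop :=
  (∀ ρ : ℝ, 0 < ρ → IntegrableOn (curvatureIntegrand s E p) (Metric.ball p ρ)ᶜ volume) ∧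
    Tendsto (fun ρ : ℝ => ∫ x in (Metric.ball p ρ)ᶜ, curvatureIntegrand s E p x)
      (𝓝[>] 0) (𝓝 H)

end

/-! ### Integrability of the kernel on thin slabs -/

section Kernel

variable {n : ℕ}

/-! Passing to `Eᶜ` preserves minimality and smoothness and changes the sign of the curvature, so it
suffices that the principal value `H` exists and that `H < 0` is impossible.

Existence: near `p` the set agrees with a half-space outside a slab `|⟪ν, z⟫| ≤ M‖z‖²`. The
half-space contributes an odd function, with zero integral on annuli. The slab has thickness of
order `r²` at distance `r`, so its contribution is of order `∫ r^(-2s) dr`, finite because `s <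
1/2`.

If `H < 0`, tilt the defining function to `ψ = φ + ‖· - p‖²` and let `A` be the part of `{ψ < δ²}`
near `p` and outside `E`; it lies in the ball of radius `δ`. For `x ∈ A`, the set `E ∪ {ψ < ψ x}`
(with `ψ` near `p`) has curvature at most `-c` at `x`, truncated at any small scale
(`exists_forall_truncated_curvature_le`): the far part is continuous in `x`, and the near part is
controlled by the slab estimate uniformly in `ν`. Integrating this over `x ∈ A`, the interactions
inside `A` cancel by symmetry (`lintegral_add_le_of_foliation`); letting the truncation tend to `0`
gives `I(A, (E ∪ A)ᶜ) + c|A| ≤ I(A, E)`. Minimality against `E ∪ A` gives `I(A, E) ≤ I(A, (E ∪ A)ᶜ)`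
with `I(A, E)` finite (`IsSPerimeterMinimizer.sInteraction_le`), which contradicts `|A| > 0`. -/

/-- The kernel `|z|^{-(n + 2s)}`. -/
noncomputable def sKernel (s : ℝ) (z : EuclideanSpace ℝ (Fin n)) : ℝ :=
  1 / ‖z‖ ^ ((n : ℝ) + 2 * s)

/-- The region between the two paraboloid-like surfaces `⟪ν, z⟫ = ±M |z|²`. -/
def quadSlab (ν : EuclideanSpace ℝ (Fin n)) (M : ℝ) : Set (EuclideanSpace ℝ (Fin n)) :=
  {z | |inner ℝ ν z| ≤ M * ‖z‖ ^ 2}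

theorem sKernel_nonneg (s : ℝ) (z : EuclideanSpace ℝ (Fin n)) : 0 ≤ sKernel s z := by
  unfold sKernel; positivity

theorem measurable_sKernel (s : ℝ) : Measurable (sKernel (n := n) s) := by
  unfold sKernel; fun_prop

theorem sKernel_neg (s : ℝ) (z : EuclideanSpace ℝ (Fin n)) : sKernel s (-z) = sKernel s z := by
  simp [sKernel]

theorem measurableSet_quadSlab (ν : EuclideanSpace ℝ (Fin n)) (M : ℝ) :
    MeasurableSet (quadSlab ν M) := by
  refine IsClosed.measurableSet (isClosed_le ?_ ?_) <;> fun_prop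

theorem sKernel_le_japanese {s : ℝ} (hs : 0 < s) {ρ : ℝ} (hρ : 0 < ρ)
    {z : EuclideanSpace ℝ (Fin n)} (hz : ρ ≤ ‖z‖) :
    sKernel s z ≤ (1 / ρ + 1) ^ ((n : ℝ) + 2 * s) * (1 + ‖z‖) ^ (-((n : ℝ) + 2 * s)) := by
  have hzp : 0 < ‖z‖ := hρ.trans_le hz
  have hq : 0 ≤ (n : ℝ) + 2 * s := by positivity
  rw [sKernel, Real.rpow_neg (by positivity), ← div_eq_mul_inv, div_le_div_iff₀ (by positivity)
    (by positivity), one_mul, ← Real.mul_rpow (by positivity) (by positivity)]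
  refine Real.rpow_le_rpow (by positivity) ?_ hq
  have : 1 ≤ 1 / ρ * ‖z‖ := by
    rw [div_mul_eq_mul_div, one_mul, le_div_iff₀ hρ]; linarith
  linarith

theorem integrable_japanese {s : ℝ} (hs : 0 < s) :
    Integrable (fun z : EuclideanSpace ℝ (Fin n) => (1 + ‖z‖) ^ (-((n : ℝ) + 2 * s))) := by
  refine integrable_one_add_norm ?_
  simp [hs]

theorem integrableOn_sKernel_compl_ball {s : ℝ} (hs : 0 < s) {ρ : ℝ} (hρ : 0 < ρ) :
    IntegrableOn (sKernel (n := n) s) (Metric.ball 0 ρ)ᶜ := by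
  refine Integrable.mono'
    (((integrable_japanese hs).const_mul ((1 / ρ + 1) ^ ((n : ℝ) + 2 * s))).integrableOn)
    (measurable_sKernel s).aestronglyMeasurable ?_
  refine (ae_restrict_iff' Metric.isOpen_ball.measurableSet.compl).2 (ae_of_all _ fun z hz => ?_)
  rw [Real.norm_of_nonneg (sKernel_nonneg s z)]
  exact sKernel_le_japanese hs hρ (by simpa using hz)

theorem integrable_indicator_abs_rpow {b : ℝ} (hb : b < 1) :
    Integrable ((Ioo (-1 : ℝ) 1).indicator fun t => |t| ^ (-b)) := by
  rw [integrable_indicator_iff measurableSet_Ioo]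
  have h1 : IntegrableOn (fun t : ℝ => |t| ^ (-b)) (Ioc 0 1) := by
    refine IntegrableOn.congr_fun (f := fun t : ℝ => t ^ (-b)) ?_ ?_ measurableSet_Ioc
    · exact (intervalIntegrable_iff_integrableOn_Ioc_of_le zero_le_one).1
        (intervalIntegral.intervalIntegrable_rpow' (by linarith))
    · intro t ht
      simp [abs_of_pos ht.1]
  have h2 : IntegrableOn (fun t : ℝ => |t| ^ (-b)) (Ico (-1) 0) := by
    have := (Measure.measurePreserving_neg (volume : Measure ℝ)).integrableOn_comp_preimage
      (MeasurableEquiv.neg ℝ).measurableEmbedding (f := fun t : ℝ => |t| ^ (-b)) (s := Ioc 0 1)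
    have h3 := this.2 h1
    have e : (Neg.neg : ℝ → ℝ) ⁻¹' (Ioc 0 1) = Ico (-1) 0 := by
      ext t; constructor <;> rintro ⟨h, h'⟩ <;> constructor <;> linarith
    rw [e] at h3
    refine h3.congr_fun (fun t _ => ?_) measurableSet_Ico
    simp
  have h0 : IntegrableOn (fun t : ℝ => |t| ^ (-b)) {0} := by
    simp [integrableOn_singleton_iff]
  refine ((h1.union h2).union h0).mono_set fun t ht => ?_
  rcases lt_trichotomy t 0 with h | h | h
  · exact Or.inl (Or.inr ⟨ht.1.le, h⟩)
  · exact Or.inr h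
  · exact Or.inl (Or.inl ⟨h, ht.2.le⟩)

/-- Points with a zero coordinate must be discarded below, since there `0 ^ (-b) = 0` would spoil
the product majorant. -/
theorem ae_forall_apply_ne_zero : ∀ᵐ z : EuclideanSpace ℝ (Fin n), ∀ i, z i ≠ 0 := by
  have h : ∀ᵐ z : Fin n → ℝ, ∀ i, z i ≠ 0 := by
    rw [ae_all_iff]
    intro i
    exact Measure.ae_eval_ne (μ := fun _ : Fin n => (volume : Measure ℝ)) i 0
  exact (PiLp.volume_preserving_ofLp (Fin n)).quasiMeasurePreserving.ae h

theorem integrable_prod_abs_rpow {b : ℝ} (hb : b < 1) :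
    Integrable (fun z : EuclideanSpace ℝ (Fin n) =>
      ∏ i, (Ioo (-1 : ℝ) 1).indicator (fun t => |t| ^ (-b)) (z i)) := by
  have h : Integrable (fun z : Fin n → ℝ =>
      ∏ i, (Ioo (-1 : ℝ) 1).indicator (fun t => |t| ^ (-b)) (z i)) :=
    Integrable.fintype_prod (fun _ => integrable_indicator_abs_rpow hb)
  exact (PiLp.volume_preserving_ofLp (Fin n)).integrable_comp_of_integrable h

/-- In the slab the small coordinate `z i` gains a factor `‖z‖`, so the kernel is dominated by a
product of one-variable powers, each integrable near `0`. This replaces polar coordinates. -/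
theorem sKernel_le_prod_of_mem_quadSlab {s : ℝ} (hs₀ : 0 < s) (hs₁ : s < 1 / 2) {M : ℝ}
    (hM : 0 < M) (i : Fin n) {z : EuclideanSpace ℝ (Fin n)} (hz : ∀ j, z j ≠ 0)
    (hzM : |z i| ≤ M * ‖z‖ ^ 2) :
    sKernel s z ≤ M ^ (2 * s + (1 - 2 * s) / 2) *
      ∏ j, |z j| ^ (-(1 - (1 - 2 * s) / 2 / n)) := by
  -- Chosen so that `2s + 2δ = 1`. Then `b < 1` and `b ≥ 2s + δ`, and the powers of `‖z‖` add up to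
  -- `2s + δ + b n = n + 2s`.
  set δ : ℝ := (1 - 2 * s) / 2 with hδ
  set b : ℝ := 1 - δ / n with hb
  have hδ0 : 0 < δ := by linarith
  have hn1 : (1 : ℝ) ≤ n := by exact_mod_cast (Nat.one_le_iff_ne_zero.2 (by
    rintro rfl; exact i.elim0))
  have hdn : δ / n ≤ δ := div_le_self hδ0.le hn1
  have hba : 0 ≤ b - (2 * s + δ) := by linarith
  have hb0 : 0 ≤ b := by linarith
  have hzp : 0 < ‖z‖ := by
    refine norm_pos_iff.2 fun h => hz i ?_
    simp [h]
  have hle : ∀ j, |z j| ≤ ‖z‖ := fun j => by simpa using PiLp.norm_apply_le z j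
  have key : ∏ j, |z j| ^ b ≤ M ^ (2 * s + δ) * ‖z‖ ^ ((n : ℝ) + 2 * s) := by
    rw [← Finset.mul_prod_erase _ _ (Finset.mem_univ i)]
    have h1 : |z i| ^ b ≤ M ^ (2 * s + δ) * ‖z‖ ^ (2 * s + δ + b) := by
      have e : b = (2 * s + δ) + (b - (2 * s + δ)) := by ring
      calc |z i| ^ b = |z i| ^ (2 * s + δ) * |z i| ^ (b - (2 * s + δ)) := by
            conv_lhs => rw [e]
            exact Real.rpow_add (abs_pos.2 (hz i)) _ _
        _ ≤ (M * ‖z‖ ^ 2) ^ (2 * s + δ) * ‖z‖ ^ (b - (2 * s + δ)) := by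
            gcongr
            exact hle i
        _ = M ^ (2 * s + δ) * ‖z‖ ^ (2 * s + δ + b) := by
            rw [Real.mul_rpow hM.le (by positivity), ← Real.rpow_natCast, ← Real.rpow_mul hzp.le,
              mul_assoc, ← Real.rpow_add hzp]
            congr 2
            push_cast
            ring
    have h2 : ∏ j ∈ Finset.univ.erase i, |z j| ^ b ≤ ‖z‖ ^ (b * ((n : ℝ) - 1)) := by
      calc ∏ j ∈ Finset.univ.erase i, |z j| ^ b ≤ ∏ j ∈ Finset.univ.erase i, ‖z‖ ^ b := by
            refine Finset.prod_le_prod (fun j _ => by positivity) fun j _ => ?_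
            exact Real.rpow_le_rpow (abs_nonneg _) (hle j) hb0
        _ = ‖z‖ ^ (b * ((n : ℝ) - 1)) := by
            rw [Finset.prod_const, Finset.card_erase_of_mem (Finset.mem_univ i),
              Finset.card_univ, Fintype.card_fin, ← Real.rpow_natCast, ← Real.rpow_mul hzp.le,
              Nat.cast_sub (by exact_mod_cast hn1), Nat.cast_one]
    calc _ ≤ M ^ (2 * s + δ) * ‖z‖ ^ (2 * s + δ + b) * ‖z‖ ^ (b * ((n : ℝ) - 1)) := by
            gcongr
      _ = M ^ (2 * s + δ) * ‖z‖ ^ ((n : ℝ) + 2 * s) := by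
            rw [mul_assoc, ← Real.rpow_add hzp]
            congr 2
            have : (n : ℝ) ≠ 0 := by linarith
            rw [hb]
            field_simp
            ring
  have hinv : ∏ j, |z j| ^ (-b) = (∏ j, |z j| ^ b)⁻¹ := by
    rw [← Finset.prod_inv_distrib]
    exact Finset.prod_congr rfl fun j _ => Real.rpow_neg (abs_nonneg _) _
  have hpos : 0 < ∏ j, |z j| ^ b :=
    Finset.prod_pos fun j _ => Real.rpow_pos_of_pos (abs_pos.2 (hz j)) _
  rw [hinv, sKernel, ← div_eq_mul_inv, div_le_div_iff₀ (by positivity) hpos, one_mul]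
  exact key

theorem integrableOn_sKernel_quadSlab_single {s : ℝ} (hs₀ : 0 < s) (hs₁ : s < 1 / 2) {M : ℝ}
    (hM : 0 < M) (i : Fin n) :
    IntegrableOn (sKernel (n := n) s)
      (Metric.ball 0 1 ∩ quadSlab (EuclideanSpace.single i (1 : ℝ)) M) := by
  have hn : (0 : ℝ) < n := by exact_mod_cast i.pos
  have hb : 1 - (1 - 2 * s) / 2 / n < 1 := by
    have : 0 < (1 - 2 * s) / 2 / n := by apply div_pos _ hn; linarith
    linarith
  refine Integrable.mono' (((integrable_prod_abs_rpow hb).const_mul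
    (M ^ (2 * s + (1 - 2 * s) / 2))).integrableOn) (measurable_sKernel s).aestronglyMeasurable ?_
  refine (ae_restrict_iff' (Metric.isOpen_ball.measurableSet.inter
    (measurableSet_quadSlab _ _))).2 ?_
  filter_upwards [ae_forall_apply_ne_zero] with z hz hzs
  rw [Real.norm_of_nonneg (sKernel_nonneg s z)]
  have h1 : ‖z‖ < 1 := by simpa using hzs.1
  refine (sKernel_le_prod_of_mem_quadSlab hs₀ hs₁ hM i hz ?_).trans_eq ?_
  · have := hzs.2
    simpa [quadSlab, EuclideanSpace.inner_single_left] using this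
  · congr 1
    refine Finset.prod_congr rfl fun j _ => ?_
    rw [indicator_of_mem]
    have hj : |z j| ≤ ‖z‖ := by simpa using PiLp.norm_apply_le z j
    exact abs_lt.1 (hj.trans_lt h1)

theorem tendsto_volume_ball_zero [Nonempty (Fin n)] :
    Tendsto (fun ρ : ℝ => volume (Metric.ball (0 : EuclideanSpace ℝ (Fin n)) ρ))
      (𝓝[>] 0) (𝓝 0) := by
  have hc := (tendsto_measure_biInter_gt (μ := volume)
    (s := fun ρ : ℝ => Metric.ball (0 : EuclideanSpace ℝ (Fin n)) ρ) (a := 0)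
    (fun r _ => Metric.isOpen_ball.measurableSet.nullMeasurableSet)
    (fun i j _ hij => Metric.ball_subset_ball hij) ⟨1, one_pos, measure_ball_lt_top.ne⟩)
  have e : (⋂ r > (0 : ℝ), Metric.ball (0 : EuclideanSpace ℝ (Fin n)) r) = {0} := by
    ext z
    simp only [mem_iInter, Metric.mem_ball, dist_zero_right, mem_singleton_iff]
    refine ⟨fun h => ?_, by rintro rfl r hr; simpa using hr⟩
    by_contra hz
    exact lt_irrefl _ (h _ (norm_pos_iff.2 hz))
  rwa [e, measure_singleton] at hc

theorem tendsto_setIntegral_sKernel_quadSlab_single {s : ℝ} (hs₀ : 0 < s) (hs₁ : s < 1 / 2)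
    {M : ℝ} (hM : 0 < M) (i : Fin n) :
    Tendsto (fun ρ : ℝ => ∫ z in Metric.ball 0 ρ ∩
      (Metric.ball 0 1 ∩ quadSlab (EuclideanSpace.single i (1 : ℝ)) M), sKernel s z)
      (𝓝[>] 0) (𝓝 0) := by
  have h := (integrableOn_sKernel_quadSlab_single hs₀ hs₁ hM i).integrable
  have : Nonempty (Fin n) := ⟨i⟩
  have hball := tendsto_volume_ball_zero (n := n)
  have h2 := h.tendsto_setIntegral_nhds_zero (l := 𝓝[>] (0 : ℝ))
    (s := fun ρ : ℝ => Metric.ball (0 : EuclideanSpace ℝ (Fin n)) ρ)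
    (tendsto_of_tendsto_of_tendsto_of_le_of_le tendsto_const_nhds hball (fun _ => zero_le)
      (fun ρ => Measure.restrict_apply_le _ _))
  refine h2.congr fun ρ => ?_
  rw [Measure.restrict_restrict Metric.isOpen_ball.measurableSet]

/-- The reflection exchanging `ν` and `‖ν‖ eᵢ` reduces every direction to a coordinate one; this
makes the slab estimate uniform in `ν`. -/
theorem exists_isometry_quadSlab_subset (i : Fin n) {a M : ℝ} (ha : 0 < a)
    {ν : EuclideanSpace ℝ (Fin n)} (hν : a ≤ ‖ν‖) :
    ∃ R : EuclideanSpace ℝ (Fin n) ≃ₗᵢ[ℝ] EuclideanSpace ℝ (Fin n),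
      quadSlab ν M ⊆ R ⁻¹' quadSlab (EuclideanSpace.single i (1 : ℝ)) (M / a) := by
  have hν0 : 0 < ‖ν‖ := ha.trans_le hν
  set e : EuclideanSpace ℝ (Fin n) := ‖ν‖ • EuclideanSpace.single i (1 : ℝ) with he
  have hen : ‖ν‖ = ‖e‖ := by simp [he, norm_smul]
  have hR := Submodule.reflection_sub hen
  refine ⟨Submodule.reflection (ℝ ∙ (ν - e))ᗮ, fun z hz => ?_⟩
  set R := Submodule.reflection (ℝ ∙ (ν - e))ᗮ
  have h1 : inner ℝ ν z = ‖ν‖ * inner ℝ (EuclideanSpace.single i (1 : ℝ)) (R z) := by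
    rw [← R.inner_map_map, hR, he, real_inner_smul_left]
  have h2 : |inner ℝ ν z| ≤ M * ‖z‖ ^ 2 := hz
  rw [h1, abs_mul, abs_of_pos hν0] at h2
  change |inner ℝ (EuclideanSpace.single i (1 : ℝ)) (R z)| ≤ M / a * ‖R z‖ ^ 2
  rw [R.norm_map, div_mul_eq_mul_div, le_div_iff₀ ha, mul_comm]
  exact (mul_le_mul_of_nonneg_right hν (abs_nonneg _)).trans h2

/-- Near the origin the kernel is integrable on `quadSlab ν M`, and its integral over a small
ball is small, uniformly in all `ν` bounded away from `0`. -/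
theorem exists_setIntegral_sKernel_quadSlab_le {s : ℝ} (hs₀ : 0 < s) (hs₁ : s < 1 / 2) {a M η : ℝ}
    (ha : 0 < a) (hM : 0 < M) (hη : 0 < η) :
    ∃ ρ₀ > 0, ∀ ρ, 0 < ρ → ρ ≤ ρ₀ → ∀ ν : EuclideanSpace ℝ (Fin n), a ≤ ‖ν‖ →
      IntegrableOn (sKernel s) (Metric.ball 0 ρ ∩ quadSlab ν M) ∧
        ∫ z in Metric.ball 0 ρ ∩ quadSlab ν M, sKernel s z ≤ η := by
  rcases Nat.eq_zero_or_pos n with rfl | hn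
  -- In dimension `0` no `ν` has positive norm.
  · refine ⟨1, one_pos, fun ρ _ _ ν hν => ?_⟩
    rw [Subsingleton.elim ν 0, norm_zero] at hν
    linarith
  set i : Fin n := ⟨0, hn⟩
  have hMa : 0 < M / a := div_pos hM ha
  have h := (tendsto_setIntegral_sKernel_quadSlab_single hs₀ hs₁ hMa i).eventually
    (eventually_le_nhds hη)
  obtain ⟨r, hr, hr'⟩ := mem_nhdsGT_iff_exists_Ioc_subset.1 h
  refine ⟨min r 1, lt_min hr one_pos, fun ρ hρ hρr ν hν => ?_⟩
  obtain ⟨R, hR⟩ := exists_isometry_quadSlab_subset i ha hν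
  set T := Metric.ball (0 : EuclideanSpace ℝ (Fin n)) ρ ∩
    (Metric.ball 0 1 ∩ quadSlab (EuclideanSpace.single i (1 : ℝ)) (M / a))
  have hT : IntegrableOn (sKernel s) T :=
    (integrableOn_sKernel_quadSlab_single hs₀ hs₁ hMa i).mono_set inter_subset_right
  have hsub : Metric.ball 0 ρ ∩ quadSlab ν M ⊆ R ⁻¹' T := by
    rintro z ⟨hz, hz'⟩
    have hz1 : ‖z‖ < ρ := by simpa using hz
    have : ρ ≤ 1 := hρr.trans (min_le_right _ _)
    refine ⟨?_, ?_, hR hz'⟩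
    · simpa using hz1
    · simpa using hz1.trans_le this
  have hK : ∀ z, sKernel s (R z) = sKernel s z := fun z => by simp [sKernel]
  have hpre : IntegrableOn (sKernel s) (R ⁻¹' T) := by
    have := (R.measurePreserving.integrableOn_comp_preimage R.toMeasurableEquiv.measurableEmbedding
      (f := sKernel s) (s := T)).2 hT
    exact this.congr_fun_ae (ae_of_all _ hK)
  refine ⟨hpre.mono_set hsub, ?_⟩
  calc ∫ z in Metric.ball 0 ρ ∩ quadSlab ν M, sKernel s z
      ≤ ∫ z in R ⁻¹' T, sKernel s z :=
        setIntegral_mono_set hpre (ae_of_all _ fun z => sKernel_nonneg s z) hsub.eventuallyLE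
    _ = ∫ z in R ⁻¹' T, sKernel s (R z) := by simp_rw [hK]
    _ = ∫ z in T, sKernel s z := R.measurePreserving.setIntegral_preimage_emb
        R.toMeasurableEquiv.measurableEmbedding _ _
    _ ≤ η := hr' ⟨hρ, hρr.trans (min_le_left _ _)⟩

end Kernel

/-! ### The curvature integrand, its odd part, and the principal value -/

section Curvature

variable {n : ℕ}

theorem curvatureIntegrand_of_mem (s : ℝ) {E : Set (EuclideanSpace ℝ (Fin n))}
    (p : EuclideanSpace ℝ (Fin n)) {x : EuclideanSpace ℝ (Fin n)} (hx : x ∈ E) :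
    curvatureIntegrand s E p x = -sKernel s (x - p) := by
  simp [curvatureIntegrand, sKernel, hx, neg_div]

theorem curvatureIntegrand_of_notMem (s : ℝ) {E : Set (EuclideanSpace ℝ (Fin n))}
    (p : EuclideanSpace ℝ (Fin n)) {x : EuclideanSpace ℝ (Fin n)} (hx : x ∉ E) :
    curvatureIntegrand s E p x = sKernel s (x - p) := by
  simp [curvatureIntegrand, sKernel, hx]

theorem norm_curvatureIntegrand (s : ℝ) (E : Set (EuclideanSpace ℝ (Fin n)))
    (p x : EuclideanSpace ℝ (Fin n)) : ‖curvatureIntegrand s E p x‖ = sKernel s (x - p) := by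
  by_cases hx : x ∈ E
  · rw [curvatureIntegrand_of_mem s p hx, norm_neg, Real.norm_of_nonneg (sKernel_nonneg _ _)]
  · rw [curvatureIntegrand_of_notMem s p hx, Real.norm_of_nonneg (sKernel_nonneg _ _)]

theorem curvatureIntegrand_compl (s : ℝ) (E : Set (EuclideanSpace ℝ (Fin n)))
    (p x : EuclideanSpace ℝ (Fin n)) :
    curvatureIntegrand s Eᶜ p x = -curvatureIntegrand s E p x := by
  by_cases hx : x ∈ E
  · rw [curvatureIntegrand_of_mem s p hx, curvatureIntegrand_of_notMem s p (by simpa using hx),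
      neg_neg]
  · rw [curvatureIntegrand_of_notMem s p hx, curvatureIntegrand_of_mem s p hx]

/-- Enlarging the set only turns some values `+K` into `-K`. -/
theorem curvatureIntegrand_anti (s : ℝ) {E G : Set (EuclideanSpace ℝ (Fin n))} (h : E ⊆ G)
    (p x : EuclideanSpace ℝ (Fin n)) :
    curvatureIntegrand s G p x ≤ curvatureIntegrand s E p x := by
  have hK := sKernel_nonneg s (x - p)
  by_cases hx : x ∈ E
  · rw [curvatureIntegrand_of_mem s p hx, curvatureIntegrand_of_mem s p (h hx)]
  · rw [curvatureIntegrand_of_notMem s p hx]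
    exact (le_abs_self _).trans_eq (norm_curvatureIntegrand s G p x)

theorem aestronglyMeasurable_curvatureIntegrand (s : ℝ) {E : Set (EuclideanSpace ℝ (Fin n))}
    (hE : NullMeasurableSet E) (p : EuclideanSpace ℝ (Fin n)) :
    AEStronglyMeasurable (curvatureIntegrand s E p) := by
  refine AEMeasurable.aestronglyMeasurable ?_
  unfold curvatureIntegrand
  exact ((aemeasurable_const.indicator₀ hE.compl).sub (aemeasurable_const.indicator₀ hE)).div
    (Measurable.aemeasurable (by fun_prop))

theorem preimage_const_add_ball (x : EuclideanSpace ℝ (Fin n)) (ρ : ℝ) :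
    (x + ·) ⁻¹' Metric.ball x ρ = Metric.ball 0 ρ := by
  ext z; simp

theorem setIntegral_const_add (f : EuclideanSpace ℝ (Fin n) → ℝ) (x : EuclideanSpace ℝ (Fin n))
    (S : Set (EuclideanSpace ℝ (Fin n))) :
    ∫ z in (x + ·) ⁻¹' S, f (x + z) = ∫ y in S, f y :=
  (measurePreserving_add_left volume x).setIntegral_preimage_emb
    (measurableEmbedding_addLeft x) f S

theorem integrableOn_const_add_iff (f : EuclideanSpace ℝ (Fin n) → ℝ)
    (x : EuclideanSpace ℝ (Fin n)) (S : Set (EuclideanSpace ℝ (Fin n))) :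
    IntegrableOn (fun z => f (x + z)) ((x + ·) ⁻¹' S) ↔ IntegrableOn f S :=
  (measurePreserving_add_left volume x).integrableOn_comp_preimage
    (measurableEmbedding_addLeft x)

theorem integrableOn_sKernel_sub {s : ℝ} (hs : 0 < s) {ρ : ℝ} (hρ : 0 < ρ)
    (p : EuclideanSpace ℝ (Fin n)) :
    IntegrableOn (fun x => sKernel s (x - p)) (Metric.ball p ρ)ᶜ := by
  rw [← integrableOn_const_add_iff, preimage_compl, preimage_const_add_ball]
  simpa using integrableOn_sKernel_compl_ball hs hρ

theorem integrableOn_curvatureIntegrand {s : ℝ} (hs : 0 < s)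
    {E : Set (EuclideanSpace ℝ (Fin n))} (hE : NullMeasurableSet E) {ρ : ℝ} (hρ : 0 < ρ)
    (p : EuclideanSpace ℝ (Fin n)) :
    IntegrableOn (curvatureIntegrand s E p) (Metric.ball p ρ)ᶜ :=
  (integrableOn_sKernel_sub hs hρ p).mono' (aestronglyMeasurable_curvatureIntegrand s hE p).restrict
    (ae_of_all _ fun x => (norm_curvatureIntegrand s E p x).le)

/-- The kernel, made odd by the sign of `⟪ν, z⟫`. -/
noncomputable def oddKernel (s : ℝ) (ν z : EuclideanSpace ℝ (Fin n)) : ℝ :=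
  Real.sign (inner ℝ ν z) * sKernel s z

theorem measurable_oddKernel (s : ℝ) (ν : EuclideanSpace ℝ (Fin n)) :
    Measurable (oddKernel s ν) := by
  have : Measurable Real.sign := by
    unfold Real.sign
    exact Measurable.ite measurableSet_Iio measurable_const
      (Measurable.ite measurableSet_Ioi measurable_const measurable_const)
  exact (this.comp (by fun_prop)).mul (measurable_sKernel s)

theorem norm_oddKernel_le (s : ℝ) (ν z : EuclideanSpace ℝ (Fin n)) :
    ‖oddKernel s ν z‖ ≤ sKernel s z := by
  have hK := sKernel_nonneg s z
  rw [oddKernel, norm_mul, Real.norm_of_nonneg hK]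
  refine mul_le_of_le_one_left hK ?_
  rcases Real.sign_apply_eq (inner ℝ ν z) with h | h | h <;> simp [h]

theorem integrableOn_oddKernel {s : ℝ} (hs : 0 < s) (ν : EuclideanSpace ℝ (Fin n)) {ε : ℝ}
    (hε : 0 < ε) : IntegrableOn (oddKernel s ν) (Metric.ball 0 ε)ᶜ :=
  (integrableOn_sKernel_compl_ball hs hε).mono' (measurable_oddKernel s ν).aestronglyMeasurable
    (ae_of_all _ fun z => norm_oddKernel_le s ν z)

theorem setIntegral_oddKernel_annulus (s : ℝ) (ν : EuclideanSpace ℝ (Fin n)) (ε ρ : ℝ) :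
    ∫ z in Metric.ball 0 ρ \ Metric.ball 0 ε, oddKernel s ν z = 0 := by
  have hm : MeasurableSet (Metric.ball (0 : EuclideanSpace ℝ (Fin n)) ρ \ Metric.ball 0 ε) :=
    Metric.isOpen_ball.measurableSet.diff Metric.isOpen_ball.measurableSet
  rw [← integral_indicator hm]
  set f := (Metric.ball (0 : EuclideanSpace ℝ (Fin n)) ρ \ Metric.ball 0 ε).indicator
    (oddKernel s ν) with hf
  have h1 : ∀ z, f (-z) = -f z := fun z => by
    by_cases hz : z ∈ Metric.ball (0 : EuclideanSpace ℝ (Fin n)) ρ \ Metric.ball 0 ε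
    · rw [hf, indicator_of_mem hz, indicator_of_mem (by simpa using hz), oddKernel, oddKernel,
        sKernel_neg, inner_neg_right, Real.sign_neg, neg_mul]
    · rw [hf, indicator_of_notMem hz, indicator_of_notMem (by simpa using hz), neg_zero]
  have h2 := integral_neg_eq_self f volume
  simp_rw [h1, integral_neg] at h2
  linarith

/-- Below the slab both sides are `-K`, above it the odd kernel is already the maximal value `K`,
and inside it the error is at most `K - (-K) = 2K`. Only one inclusion for `G` is needed. -/
theorem curvatureIntegrand_le_oddKernel_add (s : ℝ) {G : Set (EuclideanSpace ℝ (Fin n))}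
    {x ν z : EuclideanSpace ℝ (Fin n)} {M : ℝ} (hM : 0 ≤ M)
    (hG : inner ℝ ν z < -(M * ‖z‖ ^ 2) → x + z ∈ G) :
    curvatureIntegrand s G x (x + z) ≤
      oddKernel s ν z + 2 * (quadSlab ν M).indicator (sKernel s) z := by
  have hK := sKernel_nonneg s z
  have hup : curvatureIntegrand s G x (x + z) ≤ sKernel s z := by
    refine (le_abs_self _).trans_eq ?_
    rw [← Real.norm_eq_abs, norm_curvatureIntegrand, add_sub_cancel_left]
  have hodd := (abs_le.1 (norm_oddKernel_le s ν z)).1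
  by_cases hz : z ∈ quadSlab ν M
  · rw [indicator_of_mem hz]
    linarith
  · rw [indicator_of_notMem hz, mul_zero, add_zero]
    have hz' : M * ‖z‖ ^ 2 < |inner ℝ ν z| := not_le.1 hz
    have hMz : 0 ≤ M * ‖z‖ ^ 2 := by positivity
    rcases lt_abs.1 hz' with h | h
    · rw [oddKernel, Real.sign_of_pos (hMz.trans_lt h), one_mul]
      exact hup
    · rw [oddKernel, Real.sign_of_neg (by linarith),
        curvatureIntegrand_of_mem s x (hG (by linarith)), add_sub_cancel_left, neg_one_mul]

/-- If `G` contains, near `x`, the region below a downward paraboloid-like surface with normal `ν`,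
then the part of the curvature at `x` near `x` is at most twice the integral over the slab. -/
theorem setIntegral_curvatureIntegrand_annulus_le {s : ℝ} (hs : 0 < s)
    {G : Set (EuclideanSpace ℝ (Fin n))} (hG : NullMeasurableSet G)
    {x ν : EuclideanSpace ℝ (Fin n)} {M ε ρ : ℝ} (hM : 0 ≤ M) (hε : 0 < ε)
    (hK : IntegrableOn (sKernel s) (Metric.ball 0 ρ ∩ quadSlab ν M))
    (hsub : ∀ z ∈ Metric.ball 0 ρ, inner ℝ ν z < -(M * ‖z‖ ^ 2) → x + z ∈ G) :
    ∫ y in Metric.ball x ρ \ Metric.ball x ε, curvatureIntegrand s G x y ≤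
      2 * ∫ z in Metric.ball 0 ρ ∩ quadSlab ν M, sKernel s z := by
  set S := Metric.ball (0 : EuclideanSpace ℝ (Fin n)) ρ \ Metric.ball 0 ε with hS
  have hSm : MeasurableSet S := Metric.isOpen_ball.measurableSet.diff
    Metric.isOpen_ball.measurableSet
  have hSsub : S ⊆ (Metric.ball 0 ε)ᶜ := fun z hz => hz.2
  have hpre : (x + ·) ⁻¹' (Metric.ball x ρ \ Metric.ball x ε) = S := by
    rw [preimage_sdiff, preimage_const_add_ball, preimage_const_add_ball]
  have hi1 : IntegrableOn (fun z => curvatureIntegrand s G x (x + z)) S := by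
    rw [← hpre, integrableOn_const_add_iff]
    exact (integrableOn_curvatureIntegrand hs hG hε x).mono_set fun y hy => hy.2
  have hi2 : IntegrableOn (oddKernel s ν) S := (integrableOn_oddKernel hs ν hε).mono_set hSsub
  have hi3 : IntegrableOn ((quadSlab ν M).indicator (sKernel s)) S :=
    ((integrableOn_sKernel_compl_ball hs hε).mono_set hSsub).indicator (measurableSet_quadSlab _ _)
  rw [← setIntegral_const_add, hpre]
  calc ∫ z in S, curvatureIntegrand s G x (x + z)
      ≤ ∫ z in S, (oddKernel s ν z + 2 * (quadSlab ν M).indicator (sKernel s) z) :=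
        setIntegral_mono_on hi1 (hi2.add (hi3.const_mul 2)) hSm fun z hz =>
          curvatureIntegrand_le_oddKernel_add s hM (hsub z hz.1)
    _ = 2 * ∫ z in S ∩ quadSlab ν M, sKernel s z := by
        rw [integral_add hi2 (hi3.const_mul 2), setIntegral_oddKernel_annulus, zero_add,
          integral_const_mul, setIntegral_indicator (measurableSet_quadSlab _ _)]
    _ ≤ _ := by
        gcongr 2 * ?_
        exact setIntegral_mono_set hK (ae_of_all _ fun z => sKernel_nonneg s z)
          (inter_subset_inter_left _ sdiff_subset).eventuallyLE

theorem tendsto_setIntegral_compl_ball [Nonempty (Fin n)] {f : EuclideanSpace ℝ (Fin n) → ℝ}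
    (hf : Integrable f) :
    Tendsto (fun ρ : ℝ => ∫ z in (Metric.ball 0 ρ)ᶜ, f z) (𝓝[>] 0) (𝓝 (∫ z, f z)) := by
  have h := hf.tendsto_setIntegral_nhds_zero (l := 𝓝[>] (0 : ℝ)) tendsto_volume_ball_zero
  have h2 := h.const_sub (∫ z, f z)
  rw [sub_zero] at h2
  refine h2.congr fun ρ => ?_
  rw [setIntegral_compl Metric.isOpen_ball.measurableSet hf]

/-- The principal value exists at a point where the boundary lies in a slab. -/
theorem exists_hasNonlocalMeanCurvature {s : ℝ} (hs : 0 < s) [Nonempty (Fin n)]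
    {E : Set (EuclideanSpace ℝ (Fin n))} (hE : NullMeasurableSet E)
    {p ν : EuclideanSpace ℝ (Fin n)} {M r : ℝ} (hM : 0 ≤ M) (hr : 0 < r)
    (hK : IntegrableOn (sKernel s) (Metric.ball 0 r ∩ quadSlab ν M))
    (hin : ∀ z ∈ Metric.ball 0 r, inner ℝ ν z < -(M * ‖z‖ ^ 2) → p + z ∈ E)
    (hout : ∀ z ∈ Metric.ball 0 r, M * ‖z‖ ^ 2 < inner ℝ ν z → p + z ∉ E) :
    ∃ H, HasNonlocalMeanCurvature s E p H := by
  set B := Metric.ball (0 : EuclideanSpace ℝ (Fin n)) r with hB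
  have hBm : MeasurableSet B := Metric.isOpen_ball.measurableSet
  -- Subtracting the odd kernel near the origin leaves an integrable function without changing any
  -- truncated integral; the principal value is then `∫ k`.
  set k : EuclideanSpace ℝ (Fin n) → ℝ := fun z =>
    curvatureIntegrand s E p (p + z) - B.indicator (oddKernel s ν) z with hk
  have hcm : AEStronglyMeasurable (fun z => curvatureIntegrand s E p (p + z)) :=
    (aestronglyMeasurable_curvatureIntegrand s hE p).comp_measurePreserving
      (measurePreserving_add_left volume p)
  have hci : ∀ ε > 0, IntegrableOn (fun z => curvatureIntegrand s E p (p + z))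
      (Metric.ball 0 ε)ᶜ := fun ε hε => by
    have := integrableOn_curvatureIntegrand hs hE hε p
    rwa [← integrableOn_const_add_iff, preimage_compl, preimage_const_add_ball] at this
  have hkm : AEStronglyMeasurable k :=
    hcm.sub ((measurable_oddKernel s ν).indicator hBm).aestronglyMeasurable
  have hki : Integrable k := by
    rw [← integrableOn_univ, ← union_compl_self B]
    refine IntegrableOn.union ?_ ?_
    · have h1 : IntegrableOn (fun z => 2 * (quadSlab ν M).indicator (sKernel s) z) B := by
        refine Integrable.const_mul ?_ 2
        rw [integrable_indicator_iff (measurableSet_quadSlab _ _), IntegrableOn,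
          Measure.restrict_restrict (measurableSet_quadSlab _ _), inter_comm]
        exact hK
      refine h1.mono' hkm.restrict ((ae_restrict_iff' hBm).2 (ae_of_all _ fun z hz => ?_))
      simp only [hk, indicator_of_mem hz, Real.norm_eq_abs]
      refine abs_sub_le_iff.2 ⟨?_, ?_⟩
      · have := curvatureIntegrand_le_oddKernel_add s hM (hin z hz)
        linarith
      -- The lower bound is the upper bound for the complement with the opposite normal.
      · have := curvatureIntegrand_le_oddKernel_add (G := Eᶜ) (x := p) (ν := -ν) (z := z) s hM
          (fun h => hout z hz (by rw [inner_neg_left] at h; linarith))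
        have e1 : oddKernel s (-ν) z = -oddKernel s ν z := by
          rw [oddKernel, oddKernel, inner_neg_left, Real.sign_neg, neg_mul]
        have e2 : quadSlab (-ν) M = quadSlab ν M := by
          ext; simp [quadSlab]
        rw [curvatureIntegrand_compl, e1, e2] at this
        linarith
    · refine (hci r hr).congr_fun (fun z hz => ?_) hBm.compl
      have hzB : z ∉ B := hz
      simp only [hk, indicator_of_notMem hzB, sub_zero]
  refine ⟨∫ z, k z, fun ρ hρ => integrableOn_curvatureIntegrand hs hE hρ p, ?_⟩
  refine (tendsto_setIntegral_compl_ball hki).congr' ?_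
  filter_upwards [self_mem_nhdsWithin] with ρ hρ
  rw [← setIntegral_const_add (curvatureIntegrand s E p) p, preimage_compl,
    preimage_const_add_ball]
  have hρ : 0 < ρ := hρ
  have hi : IntegrableOn (B.indicator (oddKernel s ν)) (Metric.ball 0 ρ)ᶜ :=
    (integrableOn_oddKernel hs ν hρ).indicator hBm
  simp only [hk]
  rw [integral_sub (hci ρ hρ) hi, setIntegral_indicator hBm, inter_comm, ← sdiff_eq,
    setIntegral_oddKernel_annulus, sub_zero]

theorem sKernel_le_of_norm_le {s : ℝ} (hs : 0 < s) {c : ℝ} (hc : 0 < c)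
    {z w : EuclideanSpace ℝ (Fin n)} (hw : 0 < ‖w‖) (h : ‖w‖ ≤ c * ‖z‖) :
    sKernel s z ≤ c ^ ((n : ℝ) + 2 * s) * sKernel s w := by
  have hz : 0 < ‖z‖ := by
    by_contra! hz
    nlinarith
  rw [sKernel, sKernel, mul_one_div, div_le_div_iff₀ (by positivity) (by positivity), one_mul,
    ← Real.mul_rpow hc.le hz.le]
  exact Real.rpow_le_rpow hw.le h (by positivity)

/-- For fixed `ρ` the truncated curvature is continuous in the base point. -/
theorem continuousAt_truncated_curvature {s : ℝ} (hs : 0 < s)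
    {E : Set (EuclideanSpace ℝ (Fin n))} (hE : NullMeasurableSet E) {ρ : ℝ} (hρ : 0 < ρ)
    (p : EuclideanSpace ℝ (Fin n)) :
    ContinuousAt (fun x => ∫ y in (Metric.ball x ρ)ᶜ, curvatureIntegrand s E x y) p := by
  have hρ2 : 0 < ρ / 2 := by linarith
  have hm : ∀ (x : EuclideanSpace ℝ (Fin n)) (r : ℝ), MeasurableSet (Metric.ball x r)ᶜ :=
    fun x r => Metric.isOpen_ball.measurableSet.compl
  simp_rw [← integral_indicator (hm _ _)]
  -- If `‖x - p‖ < ρ / 2` and `‖y - x‖ ≥ ρ`, then `‖y - p‖ ≤ (3 / 2) ‖y - x‖`, whence the constant.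
  refine continuousAt_of_dominated (bound := fun y => (3 / 2) ^ ((n : ℝ) + 2 * s) *
    (Metric.ball p (ρ / 2))ᶜ.indicator (fun y => sKernel s (y - p)) y) ?_ ?_ ?_ ?_
  · exact Eventually.of_forall fun x =>
      (aestronglyMeasurable_curvatureIntegrand s hE x).indicator (hm x ρ)
  · filter_upwards [Metric.ball_mem_nhds p hρ2] with x hx
    refine ae_of_all _ fun y => ?_
    have hxp : ‖x - p‖ < ρ / 2 := by simpa [dist_eq_norm] using hx
    by_cases hy : y ∈ (Metric.ball x ρ)ᶜ
    · have hy' : ρ ≤ ‖y - x‖ := by simpa [dist_eq_norm] using hy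
      have h1 : ‖y - x‖ ≤ ‖y - p‖ + ‖x - p‖ := by
        simpa [norm_sub_rev p x] using norm_sub_le_norm_sub_add_norm_sub y p x
      have h2 : ‖y - p‖ ≤ ‖y - x‖ + ‖x - p‖ := norm_sub_le_norm_sub_add_norm_sub y x p
      have hyp : y ∈ (Metric.ball p (ρ / 2))ᶜ := by
        simp only [mem_compl_iff, Metric.mem_ball, dist_eq_norm, not_lt]
        linarith
      rw [indicator_of_mem hy, indicator_of_mem hyp, norm_curvatureIntegrand]
      exact sKernel_le_of_norm_le hs (by norm_num) (by linarith) (by linarith)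
    · rw [indicator_of_notMem hy, norm_zero]
      exact mul_nonneg (by positivity) (indicator_nonneg (fun y _ => sKernel_nonneg s _) y)
  · refine Integrable.const_mul ?_ _
    rw [integrable_indicator_iff (hm _ _)]
    exact integrableOn_sKernel_sub hs hρ2 p
  -- The moving domain of integration can cause a jump only for `y` on the sphere of radius `ρ`
  -- about `p`, a null set.
  · have hsph : ∀ᵐ y : EuclideanSpace ℝ (Fin n), y ∉ Metric.sphere p ρ :=
      compl_mem_ae_iff.2 (Measure.addHaar_sphere_of_ne_zero volume p hρ.ne')
    filter_upwards [hsph] with y hy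
    rcases lt_or_gt_of_ne (show dist y p ≠ ρ from hy) with h | h
    · refine (continuousAt_const (y := (0 : ℝ))).congr ?_
      have : ∀ᶠ x in 𝓝 p, dist y x < ρ :=
        (continuous_const.dist continuous_id).continuousAt.eventually_lt_const h
      filter_upwards [this] with x hx
      rw [indicator_of_notMem]
      simpa using hx
    · have hc : ContinuousAt (fun x => curvatureIntegrand s E x y) p := by
        unfold curvatureIntegrand
        refine ContinuousAt.div continuousAt_const ?_ ?_
        · refine ContinuousAt.rpow_const (by fun_prop) (Or.inr (by positivity))
        · have : 0 < ‖y - p‖ := by rw [← dist_eq_norm]; exact hρ.trans h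
          positivity
      refine hc.congr ?_
      have : ∀ᶠ x in 𝓝 p, ρ < dist y x :=
        (continuous_const.dist continuous_id).continuousAt.eventually_const_lt h
      filter_upwards [this] with x hx
      rw [indicator_of_mem]
      simpa using hx.le

end Curvature

/-! ### Uniform negativity of the curvature along a foliation -/

section Variation

variable {n : ℕ}

/-- Second order Taylor bound, uniform near a noncritical point. -/
theorem exists_quadratic_bound {ψ : EuclideanSpace ℝ (Fin n) → ℝ} {p : EuclideanSpace ℝ (Fin n)}
    (hψ : ContDiffAt ℝ 2 ψ p) (hd : fderiv ℝ ψ p ≠ 0) :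
    ∃ a > 0, ∃ M > 0, ∃ r > 0, ∀ x ∈ Metric.ball p r, ∃ ν : EuclideanSpace ℝ (Fin n), a ≤ ‖ν‖ ∧
      ∀ y ∈ Metric.ball p r, |ψ y - ψ x - inner ℝ ν (y - x)| ≤ M * ‖y - x‖ ^ 2 := by
  have hf : ContDiffAt ℝ 1 (fderiv ℝ ψ) p := hψ.fderiv_right (by norm_num)
  obtain ⟨L, T, hT, hL⟩ := hf.exists_lipschitzOnWith
  have hdiff : ∀ᶠ x in 𝓝 p, DifferentiableAt ℝ ψ x := by
    filter_upwards [hψ.eventually (by simp)] with x hx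
    exact hx.differentiableAt (by norm_num)
  have hlow : ∀ᶠ x in 𝓝 p, ‖fderiv ℝ ψ p‖ / 2 < ‖fderiv ℝ ψ x‖ :=
    hf.continuousAt.norm.eventually_const_lt (half_lt_self (norm_pos_iff.2 hd))
  obtain ⟨r, hr, hball⟩ := Metric.mem_nhds_iff.1 (inter_mem hT (inter_mem hdiff hlow))
  -- The bound is `L + 1` rather than `L` so that it is positive even when `L = 0`.
  refine ⟨‖fderiv ℝ ψ p‖ / 2, half_pos (norm_pos_iff.2 hd), L + 1, by positivity, r, hr,
    fun x hx => ⟨(InnerProductSpace.toDual ℝ _).symm (fderiv ℝ ψ x), ?_, fun y hy => ?_⟩⟩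
  · rw [LinearIsometryEquiv.norm_map]
    exact (hball hx).2.2.le
  · rw [InnerProductSpace.toDual_symm_apply, ← Real.norm_eq_abs]
    -- On this convex set the derivative differs from that at `x` by at most `L‖y - x‖`, so the mean
    -- value inequality gives a quadratic error.
    have hconv : Convex ℝ (Metric.ball p r ∩ Metric.closedBall x ‖y - x‖) :=
      (convex_ball _ _).inter (convex_closedBall _ _)
    have h := hconv.norm_image_sub_le_of_norm_fderiv_le' (𝕜 := ℝ) (f := ψ) (φ := fderiv ℝ ψ x)
      (C := L * ‖y - x‖) (x := x) (y := y) (fun z hz => (hball hz.1).2.1) (fun z hz => ?_)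
      ⟨hx, Metric.mem_closedBall_self (norm_nonneg _)⟩ ⟨hy, by simp [dist_eq_norm]⟩
    · refine h.trans ?_
      rw [sq, ← mul_assoc]
      gcongr
      linarith
    · refine (hL.norm_sub_le (hball hz.1).1 (hball hx).1).trans ?_
      gcongr
      simpa [dist_eq_norm] using hz.2

theorem nullMeasurableSet_union_sublevel {E : Set (EuclideanSpace ℝ (Fin n))}
    (hE : NullMeasurableSet E) {ψ : EuclideanSpace ℝ (Fin n) → ℝ}
    {p : EuclideanSpace ℝ (Fin n)} {r : ℝ} (hψ : ContinuousOn ψ (Metric.ball p r)) (t : ℝ) :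
    NullMeasurableSet (E ∪ {y ∈ Metric.ball p r | ψ y < t}) :=
  hE.union (hψ.isOpen_inter_preimage Metric.isOpen_ball isOpen_Iio).measurableSet.nullMeasurableSet

/-- If the nonlocal mean curvature of `E` at `p` is negative, so are, uniformly, the truncated
curvatures at nearby points `x` of the sets obtained by adding to `E` the sublevel set of `ψ`
through `x`. -/
theorem exists_forall_truncated_curvature_le {s : ℝ} (hs₀ : 0 < s) (hs₁ : s < 1 / 2)
    {E : Set (EuclideanSpace ℝ (Fin n))} (hE : NullMeasurableSet E)
    {ψ : EuclideanSpace ℝ (Fin n) → ℝ} {p : EuclideanSpace ℝ (Fin n)} {a M r H : ℝ}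
    (ha : 0 < a) (hM : 0 < M) (hr : 0 < r) (hψ : ContinuousOn ψ (Metric.ball p r))
    (htaylor : ∀ x ∈ Metric.ball p r, ∃ ν : EuclideanSpace ℝ (Fin n), a ≤ ‖ν‖ ∧
      ∀ y ∈ Metric.ball p r, |ψ y - ψ x - inner ℝ ν (y - x)| ≤ M * ‖y - x‖ ^ 2)
    (hH : HasNonlocalMeanCurvature s E p H) (hneg : H < 0) :
    ∃ δ > 0, ∃ c > 0, ∃ ε₀ > 0, ∀ x ∈ Metric.ball p δ, ∀ ε, 0 < ε → ε < ε₀ →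
      ∫ y in (Metric.ball x ε)ᶜ,
        curvatureIntegrand s (E ∪ {y ∈ Metric.ball p r | ψ y < ψ x}) x y ≤ -c := by
  -- As `H = -4c < -2c`, the far part stays below `-2c` near `p`; the near part is at most `2 · (c /
  -- 2) = c`, and the sum is below `-c`.
  set c : ℝ := -H / 4 with hc
  have hc0 : 0 < c := by linarith
  obtain ⟨ρ₀, hρ₀, hslab⟩ :=
    exists_setIntegral_sKernel_quadSlab_le (n := n) hs₀ hs₁ ha hM (half_pos hc0)
  obtain ⟨ρ, hρ, hρneg, hρle⟩ : ∃ ρ > 0, (∫ y in (Metric.ball p ρ)ᶜ,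
      curvatureIntegrand s E p y) < -2 * c ∧ ρ ≤ min ρ₀ (r / 2) := by
    have h1 := hH.2.eventually_lt_const (show H < -2 * c by linarith)
    have h2 : ∀ᶠ ρ : ℝ in 𝓝[>] 0, ρ ≤ min ρ₀ (r / 2) :=
      (eventually_le_nhds (lt_min hρ₀ (half_pos hr))).filter_mono nhdsWithin_le_nhds
    obtain ⟨ρ, ⟨h1, h2⟩, h3⟩ := ((h1.and h2).and self_mem_nhdsWithin).exists
    exact ⟨ρ, h3, h1, h2⟩
  have hcont := (continuousAt_truncated_curvature hs₀ hE hρ p).eventually_lt_const hρneg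
  obtain ⟨δ, hδ, hδc⟩ := Metric.mem_nhds_iff.1 hcont
  refine ⟨min δ (r / 2), lt_min hδ (half_pos hr), c, hc0, ρ, hρ, fun x hx ε hε hερ => ?_⟩
  have hxr : dist x p < r / 2 := (Metric.mem_ball.1 hx).trans_le (min_le_right _ _)
  have hxr' : x ∈ Metric.ball p r := by rw [Metric.mem_ball]; linarith
  obtain ⟨ν, hν, hquad⟩ := htaylor x hxr'
  obtain ⟨hK, hKle⟩ := hslab ρ hρ (hρle.trans (min_le_left _ _)) ν hν
  set G := E ∪ {y ∈ Metric.ball p r | ψ y < ψ x}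
  have hG : NullMeasurableSet G := nullMeasurableSet_union_sublevel hE hψ _
  have hnear : ∫ y in Metric.ball x ρ \ Metric.ball x ε, curvatureIntegrand s G x y ≤ c := by
    refine (setIntegral_curvatureIntegrand_annulus_le hs₀ hG hM.le hε hK fun z hz hzν =>
      ?_).trans (by linarith)
    have hz' : ‖z‖ < ρ := by simpa using hz
    have hxz : x + z ∈ Metric.ball p r := by
      rw [Metric.mem_ball]
      have h1 : dist (x + z) p ≤ dist (x + z) x + dist x p := dist_triangle _ _ _
      have h2 : dist (x + z) x = ‖z‖ := by simp [dist_eq_norm]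
      have h3 : ρ ≤ r / 2 := hρle.trans (min_le_right _ _)
      linarith
    refine Or.inr ⟨hxz, ?_⟩
    have h := hquad _ hxz
    rw [add_sub_cancel_left] at h
    have := (abs_le.1 h).2
    linarith
  have hfar : ∫ y in (Metric.ball x ρ)ᶜ, curvatureIntegrand s G x y < -2 * c := by
    refine lt_of_le_of_lt ?_ (hδc (Metric.ball_subset_ball (min_le_left _ _) hx))
    exact setIntegral_mono (integrableOn_curvatureIntegrand hs₀ hG hρ x)
      (integrableOn_curvatureIntegrand hs₀ hE hρ x)
      fun y => curvatureIntegrand_anti s subset_union_left x y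
  have hsplit : (Metric.ball x ε)ᶜ =
      (Metric.ball x ρ)ᶜ ∪ (Metric.ball x ρ \ Metric.ball x ε) := by
    ext y
    have := Metric.ball_subset_ball (x := x) hερ.le
    simp only [mem_compl_iff, mem_union, Set.mem_sdiff]
    constructor
    · intro h; by_cases hy : y ∈ Metric.ball x ρ <;> simp [hy, h]
    · rintro (h | h)
      · exact fun h' => h (this h')
      · exact h.2
  have hint := integrableOn_curvatureIntegrand hs₀ hG hε x
  rw [hsplit, setIntegral_union (disjoint_compl_left.mono_right sdiff_subset)
    (Metric.isOpen_ball.measurableSet.diff Metric.isOpen_ball.measurableSet)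
    (hint.mono_set (by rw [hsplit]; exact subset_union_left))
    (hint.mono_set (by rw [hsplit]; exact subset_union_right))]
  linarith

end Variation

/-! ### Additivity of interactions, competitors and calibration -/

section Interaction

variable {n : ℕ}

theorem sInteraction_comm (s : ℝ) (S T : Set (EuclideanSpace ℝ (Fin n))) :
    sInteraction s S T = sInteraction s T S := by
  unfold sInteraction
  rw [Measure.volume_eq_prod, ← Measure.prod_restrict, ← Measure.prod_restrict,
    ← lintegral_prod_swap]
  simp only [Prod.fst_swap, Prod.snd_swap, norm_sub_rev]

theorem sInteraction_union_left (s : ℝ) {S T R : Set (EuclideanSpace ℝ (Fin n))}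
    (hST : Disjoint S T) (hT : NullMeasurableSet T) (hR : NullMeasurableSet R) :
    sInteraction s (S ∪ T) R = sInteraction s S R + sInteraction s T R := by
  unfold sInteraction
  rw [union_prod, Measure.restrict_union₀, lintegral_add_measure]
  · exact (Disjoint.set_prod_left hST _ _).aedisjoint
  · exact hT.prod hR

theorem sInteraction_union_right (s : ℝ) {S T R : Set (EuclideanSpace ℝ (Fin n))}
    (hST : Disjoint S T) (hT : NullMeasurableSet T) (hR : NullMeasurableSet R) :
    sInteraction s R (S ∪ T) = sInteraction s R S + sInteraction s R T := by
  simp_rw [sInteraction_comm s R, sInteraction_union_left s hST hT hR]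

theorem sPerimeter_compl (s : ℝ) (E Ω : Set (EuclideanSpace ℝ (Fin n))) :
    sPerimeter s Eᶜ Ω = sPerimeter s E Ω := by
  unfold sPerimeter
  rw [compl_compl, sInteraction_comm s (Eᶜ ∩ Ω) (E ∩ Ω), sInteraction_comm s (Eᶜ ∩ Ω) (E \ Ω),
    sInteraction_comm s (Eᶜ \ Ω) (E ∩ Ω), add_right_comm]

theorem IsSPerimeterMinimizer.compl {s : ℝ} {E Ω : Set (EuclideanSpace ℝ (Fin n))}
    (h : IsSPerimeterMinimizer s E Ω) : IsSPerimeterMinimizer s Eᶜ Ω where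
  nullMeasurableSet := h.nullMeasurableSet.compl
  sPerimeter_ne_top := by rw [sPerimeter_compl]; exact h.sPerimeter_ne_top
  sPerimeter_le F hF hFE := by
    rw [sPerimeter_compl, ← sPerimeter_compl s F]
    refine h.sPerimeter_le _ hF.compl ?_
    ext x
    have := Set.ext_iff.1 hFE x
    simp only [Set.mem_sdiff, mem_compl_iff] at this ⊢
    tauto

theorem HasSmoothBoundary.compl {E : Set (EuclideanSpace ℝ (Fin n))} (h : HasSmoothBoundary E) :
    HasSmoothBoundary Eᶜ := by
  intro p hp
  rw [frontier_compl] at hp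
  obtain ⟨U, φ, hU, hpU, hφ, h0, hd, hin, hout⟩ := h p hp
  refine ⟨U, fun x => -φ x, hU, hpU, hφ.neg, by simp [h0], ?_, fun x hx hlt => ?_,
    fun x hx hlt => ?_⟩
  · rw [fderiv_fun_neg]
    exact neg_ne_zero.2 hd
  · exact hout x hx (by linarith)
  · simpa using hin x hx (by linarith)

/-- Adding `A ⊆ Eᶜ ∩ Ω` to a minimizer `E` does not decrease the energy. -/
theorem IsSPerimeterMinimizer.sInteraction_le {s : ℝ} {E Ω A : Set (EuclideanSpace ℝ (Fin n))}
    (h : IsSPerimeterMinimizer s E Ω) (hΩ : NullMeasurableSet Ω) (hA : NullMeasurableSet A)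
    (hAE : Disjoint A E) (hAΩ : A ⊆ Ω) :
    sInteraction s A E ≠ ⊤ ∧ sInteraction s A E ≤ sInteraction s A (E ∪ A)ᶜ := by
  have hE := h.nullMeasurableSet
  have hmin := h.sPerimeter_le (E ∪ A) (hE.union hA) (by
    rw [union_sdiff_distrib, sdiff_eq_empty.2 hAΩ, union_empty])
  have hfin := h.sPerimeter_ne_top
  set C := (E ∪ A)ᶜ ∩ Ω with hC
  have hCm : NullMeasurableSet C := (hE.union hA).compl.inter hΩ
  have hE1 : NullMeasurableSet (E ∩ Ω) := hE.inter hΩ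
  have hE2 : NullMeasurableSet (E \ Ω) := hE.diff hΩ
  have hC2 : NullMeasurableSet (Eᶜ \ Ω) := hE.compl.diff hΩ
  have hCA : Disjoint C A :=
    disjoint_left.2 fun x hx hxA => hx.1 (Or.inr hxA)
  have hmem : ∀ x ∈ A, x ∉ E := fun x hx => disjoint_left.1 hAE hx
  have e1 : Eᶜ ∩ Ω = C ∪ A := by
    ext x
    have h1 := hmem x
    have h2 := @hAΩ x
    simp only [hC, mem_inter_iff, mem_union, mem_compl_iff]
    tauto
  have e2 : (E ∪ A) ∩ Ω = (E ∩ Ω) ∪ A := by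
    rw [union_inter_distrib_right, inter_eq_left.2 hAΩ]
  have e3 : (E ∪ A)ᶜ \ Ω = Eᶜ \ Ω := by
    ext x
    have h2 := @hAΩ x
    simp only [Set.mem_sdiff, mem_union, mem_compl_iff]
    tauto
  have e4 : (E ∪ A) \ Ω = E \ Ω := by
    rw [union_sdiff_distrib, sdiff_eq_empty.2 hAΩ, union_empty]
  have d1 : Disjoint (E ∩ Ω) A := hAE.symm.mono_left inter_subset_left
  have i1 : sInteraction s A E = sInteraction s (E ∩ Ω) A + sInteraction s (E \ Ω) A := by
    rw [sInteraction_comm s _ A, sInteraction_comm s _ A, ← sInteraction_union_right s _ hE2 hA,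
      inter_union_sdiff]
    exact disjoint_sdiff_inter.symm
  have i2 : sInteraction s A (E ∪ A)ᶜ = sInteraction s A C + sInteraction s A (Eᶜ \ Ω) := by
    rw [← e3, ← sInteraction_union_right s disjoint_sdiff_inter.symm (by rw [e3]; exact hC2) hA,
      inter_union_sdiff]
  -- The perimeters of `E` and `E ∪ A` share the bracketed terms, which are finite and so cancel.
  have pE : sPerimeter s E Ω = (sInteraction s (E ∩ Ω) C + sInteraction s (E ∩ Ω) (Eᶜ \ Ω) +
      sInteraction s (E \ Ω) C) + sInteraction s A E := by
    rw [sPerimeter, e1, sInteraction_union_right s hCA hA hE1,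
      sInteraction_union_right s hCA hA hE2, i1]
    ring
  have pF : sPerimeter s (E ∪ A) Ω = (sInteraction s (E ∩ Ω) C +
      sInteraction s (E ∩ Ω) (Eᶜ \ Ω) + sInteraction s (E \ Ω) C) +
      sInteraction s A (E ∪ A)ᶜ := by
    rw [sPerimeter, e2, e3, e4, ← hC, sInteraction_union_left s d1 hA hCm,
      sInteraction_union_left s d1 hA hC2, i2]
    ring
  rw [pE] at hfin
  rw [pE, pF] at hmin
  rw [ENNReal.add_ne_top] at hfin
  exact ⟨hfin.2, (ENNReal.add_le_add_iff_left hfin.1).1 hmin⟩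

/-- A calibration argument: if the sets `E ∪ {y ∈ A | ψ y < ψ x}` have "`k`-curvature" at most `-c`
at `x`, for all `x ∈ A`, then adding `A` to `E` lowers the energy by at least `c |A|`; the
interactions inside `A` cancel by symmetry. -/
theorem lintegral_add_le_of_foliation {k : EuclideanSpace ℝ (Fin n) → ℝ≥0∞} (hk : Measurable k)
    (hkeven : ∀ z, k (-z) = k z) (hkfin : ∫⁻ z, k z ≠ ⊤)
    {A E : Set (EuclideanSpace ℝ (Fin n))} (hA : NullMeasurableSet A) (hAfin : volume A ≠ ⊤)
    (hAE : Disjoint A E) {ψ : EuclideanSpace ℝ (Fin n) → ℝ}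
    (hψ : Measurable ψ) {c : ℝ≥0∞}
    (h : ∀ x ∈ A, (∫⁻ y in (E ∪ {y ∈ A | ψ y < ψ x})ᶜ, k (x - y)) + c ≤
      ∫⁻ y in E ∪ {y ∈ A | ψ y < ψ x}, k (x - y)) :
    (∫⁻ z in A ×ˢ (E ∪ A)ᶜ, k (z.1 - z.2)) + c * volume A ≤ ∫⁻ z in A ×ˢ E, k (z.1 - z.2) := by
  set m : EuclideanSpace ℝ (Fin n) → EuclideanSpace ℝ (Fin n) → ℝ≥0∞ := fun x y =>
    {y | ψ y < ψ x}.indicator (fun y => k (x - y)) y with hm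
  set m' : EuclideanSpace ℝ (Fin n) → EuclideanSpace ℝ (Fin n) → ℝ≥0∞ := fun x y =>
    {y | ψ x ≤ ψ y}.indicator (fun y => k (x - y)) y with hm'
  have hkd : Measurable fun z : EuclideanSpace ℝ (Fin n) × EuclideanSpace ℝ (Fin n) =>
      k (z.1 - z.2) := hk.comp (by fun_prop)
  have hmm : Measurable (Function.uncurry m) :=
    hkd.indicator (measurableSet_lt (hψ.comp measurable_snd) (hψ.comp measurable_fst))
  have hmm' : Measurable (Function.uncurry m') :=
    hkd.indicator (measurableSet_le (hψ.comp measurable_fst) (hψ.comp measurable_snd))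
  have hlt : ∀ t, MeasurableSet {y | ψ y < t} := fun t => measurableSet_lt hψ measurable_const
  have hge : ∀ t, MeasurableSet {y | t ≤ ψ y} := fun t => measurableSet_le measurable_const hψ
  have hpt : ∀ x ∈ A, (∫⁻ y in (E ∪ A)ᶜ, k (x - y)) + c + ∫⁻ y in A, m' x y ≤
      (∫⁻ y in E, k (x - y)) + ∫⁻ y in A, m x y := fun x hx => by
    have e1 : ∫⁻ y in A, m x y = ∫⁻ y in {y ∈ A | ψ y < ψ x}, k (x - y) := by
      rw [hm, lintegral_indicator (hlt _), Measure.restrict_restrict (hlt _), inter_comm]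
      rfl
    have e2 : ∫⁻ y in A, m' x y = ∫⁻ y in A ∩ {y | ψ x ≤ ψ y}, k (x - y) := by
      rw [hm', lintegral_indicator (hge _), Measure.restrict_restrict (hge _), inter_comm]
    have e3 : (E ∪ {y ∈ A | ψ y < ψ x})ᶜ = (E ∪ A)ᶜ ∪ (A ∩ {y | ψ x ≤ ψ y}) := by
      ext y
      have : y ∈ A → y ∉ E := fun hy => disjoint_left.1 hAE hy
      simp only [mem_compl_iff, mem_union, mem_ofPred_eq, mem_inter_iff]
      rw [← not_lt]
      tauto
    have e4 : (∫⁻ y in (E ∪ {y ∈ A | ψ y < ψ x})ᶜ, k (x - y)) =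
        (∫⁻ y in (E ∪ A)ᶜ, k (x - y)) + ∫⁻ y in A, m' x y := by
      rw [e2, e3, Measure.restrict_union₀, lintegral_add_measure]
      · exact Disjoint.aedisjoint (disjoint_left.2 fun y hy hy' => hy (Or.inr hy'.1))
      · exact hA.inter (hge _).nullMeasurableSet
    calc _ = (∫⁻ y in (E ∪ {y ∈ A | ψ y < ψ x})ᶜ, k (x - y)) + c := by
          rw [e4, add_right_comm]
      _ ≤ ∫⁻ y in E ∪ {y ∈ A | ψ y < ψ x}, k (x - y) := h x hx
      _ ≤ _ := by rw [e1]; exact lintegral_union_le _ _ _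
  have hJ : ∀ S : Set (EuclideanSpace ℝ (Fin n)), Measurable fun x => ∫⁻ y in S, k (x - y) :=
    fun S => hkd.lintegral_prod_right'
  have hprod : ∀ S : Set (EuclideanSpace ℝ (Fin n)),
      ∫⁻ z in A ×ˢ S, k (z.1 - z.2) = ∫⁻ x in A, ∫⁻ y in S, k (x - y) := fun S => by
    rw [Measure.volume_eq_prod, ← Measure.prod_restrict, lintegral_prod _ hkd.aemeasurable]
  have hM : Measurable fun x => ∫⁻ y in A, m x y := hmm.lintegral_prod_right'
  have hM' : Measurable fun x => ∫⁻ y in A, m' x y := hmm'.lintegral_prod_right'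
  -- Exchanging `x` and `y` sends pairs with `ψ y < ψ x` to pairs with the opposite strict
  -- inequality. Ties are counted only in `m'`, so `≤` results, which is the direction needed.
  have hsymm : ∫⁻ x in A, ∫⁻ y in A, m x y ≤ ∫⁻ x in A, ∫⁻ y in A, m' x y := by
    rw [lintegral_lintegral_swap hmm.aemeasurable]
    refine lintegral_mono fun y => lintegral_mono fun x => ?_
    simp only [hm, hm']
    by_cases hxy : ψ y < ψ x
    · rw [indicator_of_mem (show y ∈ {y | ψ y < ψ x} from hxy),
        indicator_of_mem (show x ∈ {x | ψ y ≤ ψ x} from hxy.le), ← hkeven, neg_sub]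
    · rw [indicator_of_notMem (show y ∉ {y | ψ y < ψ x} from hxy)]
      exact zero_le
  -- Cancelling the inner interactions requires finiteness; here integrability of `k` enters, which
  -- is why the kernel is truncated in the application.
  have hfin : ∫⁻ x in A, ∫⁻ y in A, m x y ≠ ⊤ := by
    refine ne_top_of_le_ne_top (b := ∫⁻ _ in A, ∫⁻ z, k z) ?_ (lintegral_mono fun x => ?_)
    · rw [setLIntegral_const]
      exact ENNReal.mul_ne_top hkfin hAfin
    · calc ∫⁻ y in A, m x y ≤ ∫⁻ y, m x y := setLIntegral_le_lintegral _ _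
        _ ≤ ∫⁻ y, k (x - y) := lintegral_mono fun y => indicator_le_self _ _ _
        _ = ∫⁻ z, k z := lintegral_sub_left_eq_self k x
  have hint := lintegral_mono_ae ((ae_restrict_iff'₀ hA).2 (ae_of_all volume hpt))
  rw [lintegral_add_right _ hM', lintegral_add_right _ measurable_const, lintegral_add_right _ hM,
    setLIntegral_const, ← hprod, ← hprod] at hint
  refine (ENNReal.add_le_add_iff_right hfin).1 (le_trans ?_ hint)
  gcongr

end Interaction

/-! ### Truncated kernels and the contradiction with minimality -/

section Minimizer

variable {n : ℕ}

/-- The kernel, cut off inside the ball of radius `ε`, with values in `[0, ∞]`. -/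
noncomputable def truncatedKernel (s ε : ℝ) (z : EuclideanSpace ℝ (Fin n)) : ℝ≥0∞ :=
  (Metric.ball 0 ε)ᶜ.indicator (fun z => ENNReal.ofReal (sKernel s z)) z

theorem measurable_truncatedKernel (s ε : ℝ) : Measurable (truncatedKernel (n := n) s ε) :=
  (measurable_sKernel s).ennreal_ofReal.indicator Metric.isOpen_ball.measurableSet.compl

theorem truncatedKernel_neg (s ε : ℝ) (z : EuclideanSpace ℝ (Fin n)) :
    truncatedKernel s ε (-z) = truncatedKernel s ε z := by
  by_cases h : z ∈ (Metric.ball (0 : EuclideanSpace ℝ (Fin n)) ε)ᶜ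
  · rw [truncatedKernel, truncatedKernel, indicator_of_mem h, indicator_of_mem (by simpa using h),
      sKernel_neg]
  · rw [truncatedKernel, truncatedKernel, indicator_of_notMem h,
      indicator_of_notMem (by simpa using h)]

theorem lintegral_truncatedKernel_ne_top {s ε : ℝ} (hs : 0 < s) (hε : 0 < ε) :
    ∫⁻ z : EuclideanSpace ℝ (Fin n), truncatedKernel s ε z ≠ ⊤ := by
  unfold truncatedKernel
  rw [lintegral_indicator Metric.isOpen_ball.measurableSet.compl,
    ← ofReal_integral_eq_lintegral_ofReal (integrableOn_sKernel_compl_ball hs hε)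
      (ae_of_all _ fun z => sKernel_nonneg s z)]
  exact ENNReal.ofReal_ne_top

theorem truncatedKernel_le (s ε : ℝ) (z : EuclideanSpace ℝ (Fin n)) :
    truncatedKernel s ε z ≤ ENNReal.ofReal (sKernel s z) :=
  indicator_le_self _ _ _

theorem tendsto_truncatedKernel {s : ℝ} (hs : 0 < s) {u : ℕ → ℝ} (hu : Tendsto u atTop (𝓝 0))
    (z : EuclideanSpace ℝ (Fin n)) :
    Tendsto (fun j => truncatedKernel s (u j) z) atTop (𝓝 (ENNReal.ofReal (sKernel s z))) := by
  -- At the origin the convention `1 / 0 = 0` makes the kernel vanish, so convergence holds there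
  -- too.
  by_cases hz : z = 0
  · have h0 : sKernel s z = 0 := by
      rw [sKernel, hz, norm_zero, Real.zero_rpow (by positivity), div_zero]
    have : ∀ j, truncatedKernel s (u j) z = 0 := fun j =>
      le_antisymm ((truncatedKernel_le s _ z).trans (by simp [h0])) zero_le
    simp [this, h0]
  · refine tendsto_const_nhds.congr' ?_
    filter_upwards [hu.eventually_lt_const (norm_pos_iff.2 hz)] with j hj
    rw [truncatedKernel, indicator_of_mem]
    simpa using hj.le

theorem truncatedKernel_antitone (s : ℝ) (z : EuclideanSpace ℝ (Fin n)) :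
    Antitone fun ε => truncatedKernel s ε z := fun _ _ h =>
  indicator_le_indicator_of_subset (compl_subset_compl.2 (Metric.ball_subset_ball h))
    (fun _ => zero_le) z

theorem setLIntegral_truncatedKernel {s ε : ℝ} (hs : 0 < s) (hε : 0 < ε)
    (S : Set (EuclideanSpace ℝ (Fin n))) (x : EuclideanSpace ℝ (Fin n)) :
    ∫⁻ y in S, truncatedKernel s ε (x - y) =
      ENNReal.ofReal (∫ y in (Metric.ball x ε)ᶜ ∩ S, sKernel s (y - x)) := by
  have h : ∀ y, truncatedKernel s ε (x - y) =
      (Metric.ball x ε)ᶜ.indicator (fun y => ENNReal.ofReal (sKernel s (y - x))) y := fun y => by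
    by_cases hy : y ∈ (Metric.ball x ε)ᶜ
    · rw [indicator_of_mem hy, truncatedKernel, indicator_of_mem, ← sKernel_neg, neg_sub]
      simpa [dist_eq_norm, norm_sub_rev] using hy
    · rw [indicator_of_notMem hy, truncatedKernel, indicator_of_notMem]
      simpa [dist_eq_norm, norm_sub_rev] using hy
  have hm : MeasurableSet (Metric.ball x ε)ᶜ := Metric.isOpen_ball.measurableSet.compl
  simp_rw [h]
  rw [lintegral_indicator hm, Measure.restrict_restrict hm,
    ofReal_integral_eq_lintegral_ofReal
      ((integrableOn_sKernel_sub hs hε x).mono_set inter_subset_left)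
      (ae_of_all _ fun y => sKernel_nonneg s _)]

/-- The truncated integrals over `G` and `Gᶜ` are finite, so the signed curvature bound can be
rearranged into an inequality in `[0, ∞]`. -/
theorem setLIntegral_truncatedKernel_add_le {s ε c : ℝ} (hs : 0 < s) (hε : 0 < ε) (hc : 0 ≤ c)
    {G : Set (EuclideanSpace ℝ (Fin n))} (hG : NullMeasurableSet G)
    {x : EuclideanSpace ℝ (Fin n)}
    (h : ∫ y in (Metric.ball x ε)ᶜ, curvatureIntegrand s G x y ≤ -c) :
    (∫⁻ y in Gᶜ, truncatedKernel s ε (x - y)) + ENNReal.ofReal c ≤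
      ∫⁻ y in G, truncatedKernel s ε (x - y) := by
  have hm : NullMeasurableSet (Metric.ball x ε)ᶜ :=
    Metric.isOpen_ball.measurableSet.compl.nullMeasurableSet
  have h1 : ∫ y in (Metric.ball x ε)ᶜ ∩ G, curvatureIntegrand s G x y =
      -∫ y in (Metric.ball x ε)ᶜ ∩ G, sKernel s (y - x) := by
    rw [← integral_neg]
    exact integral_congr_ae ((ae_restrict_iff'₀ (hm.inter hG)).2
      (ae_of_all _ fun y hy => curvatureIntegrand_of_mem s x hy.2))
  have h2 : ∫ y in (Metric.ball x ε)ᶜ ∩ Gᶜ, curvatureIntegrand s G x y =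
      ∫ y in (Metric.ball x ε)ᶜ ∩ Gᶜ, sKernel s (y - x) :=
    integral_congr_ae ((ae_restrict_iff'₀ (hm.inter hG.compl)).2
      (ae_of_all _ fun y hy => curvatureIntegrand_of_notMem s x hy.2))
  have h3 := integral_inter_add_sdiff₀ hG (integrableOn_curvatureIntegrand hs hG hε x)
  rw [sdiff_eq, h1, h2] at h3
  rw [setLIntegral_truncatedKernel hs hε, setLIntegral_truncatedKernel hs hε,
    ← ENNReal.ofReal_add (integral_nonneg fun y => sKernel_nonneg s _) hc]
  exact ENNReal.ofReal_le_ofReal (by linarith)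

theorem tendsto_setLIntegral_truncatedKernel {s : ℝ} (hs : 0 < s) {u : ℕ → ℝ} (hu : Antitone u)
    (hu0 : Tendsto u atTop (𝓝 0)) (S T : Set (EuclideanSpace ℝ (Fin n))) :
    Tendsto (fun j => ∫⁻ z in S ×ˢ T, truncatedKernel s (u j) (z.1 - z.2)) atTop
      (𝓝 (sInteraction s S T)) := by
  refine lintegral_tendsto_of_tendsto_of_monotone (fun j => ?_) (ae_of_all _ fun z => ?_)
    (ae_of_all _ fun z => tendsto_truncatedKernel hs hu0 (z.1 - z.2))
  · exact ((measurable_truncatedKernel s (u j)).comp (by fun_prop)).aemeasurable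
  · exact fun i j hij => truncatedKernel_antitone s _ (hu hij)

theorem exists_pos_of_fderiv_ne_zero {φ : EuclideanSpace ℝ (Fin n) → ℝ}
    {p : EuclideanSpace ℝ (Fin n)} (h0 : φ p = 0) (hd : fderiv ℝ φ p ≠ 0) :
    ∃ᶠ x in 𝓝 p, 0 < φ x := by
  intro h
  refine hd (IsLocalMax.fderiv_eq_zero ?_)
  filter_upwards [h] with x hx
  rw [h0]
  exact not_lt.1 hx

theorem nonneg_of_isSPerimeterMinimizer {s : ℝ} (hs₀ : 0 < s) (hs₁ : s < 1 / 2)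
    {Ω E : Set (EuclideanSpace ℝ (Fin n))} (hΩ : IsOpen Ω) (hE : HasSmoothBoundary E)
    (hmin : IsSPerimeterMinimizer s E Ω) {p : EuclideanSpace ℝ (Fin n)}
    (hp : p ∈ frontier E ∩ Ω) {H : ℝ} (hH : HasNonlocalMeanCurvature s E p H) : 0 ≤ H := by
  by_contra! hneg
  obtain ⟨U, φ, hU, hpU, hφ, h0, hd, hin, hout⟩ := hE p hp.1
  -- The quadratic term keeps the differential at `p` and confines `{ψ < δ²}` outside `E`, where `φ
  -- ≥ 0`, to the ball of radius `δ`.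
  set ψ : EuclideanSpace ℝ (Fin n) → ℝ := fun y => φ y + ‖y - p‖ ^ 2 with hψ
  have hq : ContDiff ℝ 2 fun y : EuclideanSpace ℝ (Fin n) => ‖y - p‖ ^ 2 :=
    (contDiff_id.sub contDiff_const).norm_sq ℝ
  have hφU : ContDiffAt ℝ 2 φ p :=
    (hφ.contDiffAt (hU.mem_nhds hpU)).of_le (WithTop.coe_le_coe.2 (le_top : (2 : ℕ∞) ≤ ⊤))
  have hψp : ContDiffAt ℝ 2 ψ p := hφU.add hq.contDiffAt
  have hdψ : fderiv ℝ ψ p ≠ 0 := by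
    have h1 : fderiv ℝ (fun y : EuclideanSpace ℝ (Fin n) => ‖y - p‖ ^ 2) p = 0 :=
      IsLocalMin.fderiv_eq_zero (Eventually.of_forall fun y => by simp)
    rw [hψ, fderiv_fun_add (hφU.differentiableAt (by norm_num))
      (hq.differentiable (by norm_num)).differentiableAt, h1, add_zero]
    exact hd
  have hψ0 : ψ p = 0 := by simp [hψ, h0]
  have hψU : ContinuousOn ψ U := hφ.continuousOn.add hq.continuous.continuousOn
  obtain ⟨a, ha, M, hM, r₁, hr₁, htaylor⟩ := exists_quadratic_bound hψp hdψ
  obtain ⟨r₂, hr₂, hr₂U⟩ := Metric.isOpen_iff.1 (hU.inter hΩ) p ⟨hpU, hp.2⟩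
  set r := min r₁ r₂
  have hr : 0 < r := lt_min hr₁ hr₂
  have hrU : Metric.ball p r ⊆ U ∩ Ω :=
    (Metric.ball_subset_ball (min_le_right _ _)).trans hr₂U
  have hr₁' : Metric.ball p r ⊆ Metric.ball p r₁ := Metric.ball_subset_ball (min_le_left _ _)
  have hψr : ContinuousOn ψ (Metric.ball p r) := hψU.mono (hrU.trans inter_subset_left)
  have hEm := hmin.nullMeasurableSet
  obtain ⟨δ, hδ, c, hc, ε₀, hε₀, hcurv⟩ := exists_forall_truncated_curvature_le hs₀ hs₁ hEm ha hM hr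
    hψr (fun x hx => (htaylor x (hr₁' hx)).imp fun ν h => ⟨h.1, fun y hy => h.2 y (hr₁' hy)⟩)
    hH hneg
  set D := Metric.ball p r ∩ ψ ⁻¹' Iio (δ ^ 2) with hD
  have hDo : IsOpen D := hψr.isOpen_inter_preimage Metric.isOpen_ball isOpen_Iio
  set A := D \ E with hA
  have hAm : NullMeasurableSet A := hDo.measurableSet.nullMeasurableSet.diff hEm
  have hAE : Disjoint A E := disjoint_sdiff_left
  have hAδ : A ⊆ Metric.ball p δ := fun x hx => by
    have h1 : 0 ≤ φ x := not_lt.1 fun h => hx.2 (hin x (hrU hx.1.1).1 h)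
    have h2 : φ x + ‖x - p‖ ^ 2 < δ ^ 2 := hx.1.2
    rw [Metric.mem_ball, dist_eq_norm]
    exact lt_of_pow_lt_pow_left₀ 2 hδ.le (by linarith)
  have hAfin : volume A ≠ ⊤ :=
    ne_top_of_le_ne_top measure_ball_lt_top.ne (measure_mono hAδ)
  -- Since `p` is not a local maximum of `φ`, the open set `{φ > 0}` meets `D`, and there it lies
  -- outside `E`.
  have hApos : volume A ≠ 0 := by
    have hφD : IsOpen (D ∩ φ ⁻¹' Ioi 0) :=
      (hφ.continuousOn.mono fun x hx => (hrU hx.1).1).isOpen_inter_preimage hDo isOpen_Ioi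
    have hpD : D ∈ 𝓝 p := hDo.mem_nhds ⟨Metric.mem_ball_self hr, by
      rw [mem_preimage, hψ0]; exact pow_pos hδ 2⟩
    obtain ⟨x, hx, hxD⟩ := ((exists_pos_of_fderiv_ne_zero h0 hd).and_eventually hpD).exists
    have hpos := hφD.measure_pos volume ⟨x, hxD, hx⟩
    have hsub : D ∩ φ ⁻¹' Ioi 0 ⊆ A := fun y hy => ⟨hy.1, hout y (hrU hy.1.1).1 hy.2⟩
    exact (hpos.trans_le (measure_mono hsub)).ne'
  -- `ψ` is controlled only near `p`; extension by zero makes it globally measurable and keeps its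
  -- values on `A`.
  set ψ' : EuclideanSpace ℝ (Fin n) → ℝ := (Metric.ball p r).indicator ψ with hψ'
  have hψ'm : Measurable ψ' := by
    classical
    rw [hψ', ← piecewise_eq_indicator]
    exact hψr.measurable_piecewise continuousOn_const Metric.isOpen_ball.measurableSet
  have hψ'A : ∀ x ∈ A, ψ' x = ψ x := fun x hx => indicator_of_mem hx.1.1 ψ
  have hG : ∀ x ∈ A, E ∪ {y ∈ A | ψ' y < ψ' x} = E ∪ {y ∈ Metric.ball p r | ψ y < ψ x} :=
    fun x hx => by
    ext y
    by_cases hy : y ∈ E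
    · simp [hy]
    · simp only [mem_union, hy, false_or, mem_ofPred_eq, hψ'A x hx]
      refine ⟨fun h => ⟨h.1.1.1, hψ'A y h.1 ▸ h.2⟩, fun h => ?_⟩
      -- `ψ y < ψ x < δ²` puts `y` in `D`, so the sublevel sets in `A` and in the ball agree off
      -- `E`.
      have hyA : y ∈ A := ⟨⟨h.1, h.2.trans hx.1.2⟩, hy⟩
      exact ⟨hyA, (hψ'A y hyA).symm ▸ h.2⟩
  have htrunc : ∀ ε, 0 < ε → ε < ε₀ →
      (∫⁻ z in A ×ˢ (E ∪ A)ᶜ, truncatedKernel s ε (z.1 - z.2)) + ENNReal.ofReal c * volume A ≤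
        ∫⁻ z in A ×ˢ E, truncatedKernel s ε (z.1 - z.2) := fun ε hε hεε₀ => by
    refine lintegral_add_le_of_foliation (measurable_truncatedKernel s ε) (truncatedKernel_neg s ε)
      (lintegral_truncatedKernel_ne_top hs₀ hε) hAm hAfin hAE hψ'm fun x hx => ?_
    rw [hG x hx]
    exact setLIntegral_truncatedKernel_add_le hs₀ hε hc.le
      (nullMeasurableSet_union_sublevel hEm hψr _) (hcurv x (hAδ hx) ε hε hεε₀)
  have hu0 : Tendsto (fun j : ℕ => 1 / ((j : ℝ) + 1)) atTop (𝓝 0) :=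
    tendsto_one_div_add_atTop_nhds_zero_nat
  have hua : Antitone fun j : ℕ => 1 / ((j : ℝ) + 1) := fun i j hij =>
    Nat.one_div_le_one_div hij
  -- The constant `c` does not depend on `ε`, so the gain `c|A|` survives the monotone limit.
  have hlim : sInteraction s A (E ∪ A)ᶜ + ENNReal.ofReal c * volume A ≤ sInteraction s A E := by
    refine le_of_tendsto_of_tendsto
      ((tendsto_setLIntegral_truncatedKernel hs₀ hua hu0 A (E ∪ A)ᶜ).add_const _)
      (tendsto_setLIntegral_truncatedKernel hs₀ hua hu0 A E) ?_
    filter_upwards [hu0.eventually_lt_const hε₀] with j hj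
    exact htrunc _ Nat.one_div_pos_of_nat hj
  obtain ⟨hfin, hle⟩ := hmin.sInteraction_le hΩ.measurableSet.nullMeasurableSet hAm hAE
    fun x hx => (hrU hx.1.1).2
  have h1 : sInteraction s A E + ENNReal.ofReal c * volume A ≤ sInteraction s A E + 0 := by
    rw [add_zero]
    exact (add_le_add_left hle _).trans hlim
  have h2 := (ENNReal.add_le_add_iff_left hfin).1 h1
  have h3 : ENNReal.ofReal c * volume A ≠ 0 := mul_ne_zero (by simpa using hc) hApos
  exact h3 (le_antisymm h2 zero_le)

theorem HasSmoothBoundary.exists_hasNonlocalMeanCurvature {s : ℝ} (hs₀ : 0 < s) (hs₁ : s < 1 / 2)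
    {E : Set (EuclideanSpace ℝ (Fin n))} (hE : HasSmoothBoundary E) (hEm : NullMeasurableSet E)
    {p : EuclideanSpace ℝ (Fin n)} (hp : p ∈ frontier E) :
    ∃ H, HasNonlocalMeanCurvature s E p H := by
  obtain ⟨U, φ, hU, hpU, hφ, h0, hd, hin, hout⟩ := hE p hp
  -- A nonzero differential excludes dimension `0`.
  have hn : Nonempty (Fin n) := by
    by_contra hn
    rw [not_nonempty_iff] at hn
    exact hd (Subsingleton.elim _ _)
  have hφp : ContDiffAt ℝ 2 φ p :=
    (hφ.contDiffAt (hU.mem_nhds hpU)).of_le (WithTop.coe_le_coe.2 (le_top : (2 : ℕ∞) ≤ ⊤))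
  obtain ⟨a, ha, M, hM, r₁, hr₁, htaylor⟩ := exists_quadratic_bound hφp hd
  obtain ⟨ν, hν, hquad⟩ := htaylor p (Metric.mem_ball_self hr₁)
  obtain ⟨r₂, hr₂, hr₂U⟩ := Metric.isOpen_iff.1 hU p hpU
  obtain ⟨ρ₀, hρ₀, hslab⟩ :=
    exists_setIntegral_sKernel_quadSlab_le (n := n) hs₀ hs₁ ha hM one_pos
  set r := min ρ₀ (min r₁ r₂)
  have hr : 0 < r := lt_min hρ₀ (lt_min hr₁ hr₂)
  have hmem : ∀ z ∈ Metric.ball (0 : EuclideanSpace ℝ (Fin n)) r,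
      p + z ∈ U ∧ |φ (p + z) - inner ℝ ν z| ≤ M * ‖z‖ ^ 2 := fun z hz => by
    have hz' : ‖z‖ < r := by simpa using hz
    refine ⟨hr₂U ?_, ?_⟩
    · simpa using hz'.trans_le ((min_le_right _ _).trans (min_le_right _ _))
    · have := hquad (p + z) (by
        simpa using hz'.trans_le ((min_le_right _ _).trans (min_le_left _ _)))
      simpa [h0] using this
  refine _root_.exists_hasNonlocalMeanCurvature hs₀ hEm hM.le hr
    (hslab r hr (min_le_left _ _) ν hν).1 (fun z hz h => ?_) (fun z hz h => ?_)
  · obtain ⟨h1, h2⟩ := hmem z hz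
    exact hin _ h1 (by linarith [(abs_le.1 h2).2])
  · obtain ⟨h1, h2⟩ := hmem z hz
    exact hout _ h1 (by linarith [(abs_le.1 h2).1])

theorem HasNonlocalMeanCurvature.compl {s : ℝ} {E : Set (EuclideanSpace ℝ (Fin n))}
    {p : EuclideanSpace ℝ (Fin n)} {H : ℝ} (h : HasNonlocalMeanCurvature s E p H) :
    HasNonlocalMeanCurvature s Eᶜ p (-H) := by
  have e : curvatureIntegrand s Eᶜ p = fun x => -curvatureIntegrand s E p x :=
    funext (curvatureIntegrand_compl s E p)
  refine ⟨fun ρ hρ => ?_, ?_⟩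
  · rw [e]
    exact (h.1 ρ hρ).neg
  · simp_rw [e, integral_neg]
    exact h.2.neg

end Minimizer

theorem lemma1p1 {n : ℕ} (s : ℝ) (hs₀ : 0 < s) (hs₁ : s < 1 / 2)
    (Ω E : Set (EuclideanSpace ℝ (Fin n))) (hΩ : IsOpen Ω) (hE : HasSmoothBoundary E)
    (hmin : IsSPerimeterMinimizer s E Ω) (p : EuclideanSpace ℝ (Fin n))
    (hp : p ∈ frontier E ∩ Ω) :
    HasNonlocalMeanCurvature s E p 0 := by
  obtain ⟨H, hH⟩ := hE.exists_hasNonlocalMeanCurvature hs₀ hs₁ hmin.nullMeasurableSet hp.1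
  have h1 : 0 ≤ H := nonneg_of_isSPerimeterMinimizer hs₀ hs₁ hΩ hE hmin hp hH
  have h2 : 0 ≤ -H := nonneg_of_isSPerimeterMinimizer hs₀ hs₁ hΩ hE.compl hmin.compl
    (by rwa [frontier_compl]) hH.compl
  rwa [show H = 0 by linarith] at hH
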